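/- For an integrable $g:(-\pi,\pi)\to\mathbb{C}$ let $T_n(g)$ be the $n\times n$ Toeplitz matrix with entries $t_{jk}=\frac{1}{2\pi}\int_{-\pi}^{\pi}g(x)e^{-i(j-k)x}\,dx$, $1\le j,k\le n$. Let $f\in L^2(-\pi,\pi)$ be complex-valued and let $p$ be a trigonometric polynomial (with complex coefficients) such that $\operatorname{Re}(f/p)>0$ almost everywhere and $$0<\alpha=\operatorname*{ess\,inf}_{-\pi\le x\le\pi}\left|\frac{f(x)}{p(x)}\right|\le\operatorname*{ess\,sup}_{-\pi\le x\le\pi}\left|\frac{f(x)}{p(x)}\right|=\beta<\infty .$$ Then $[\alpha,\beta]$ is a general cluster for the singular values of the preconditioned matrices $T_n(p)^{-1}T_n(f)$, where $n$ runs through the orders for which $T_n(p)$ is invertible: for every $\varepsilon>0$, if $\gamma_n(\varepsilon)$ denotes the number (counted with multiplicity) of singular values of $T_n(p)^{-1}T_n(f)$ lying outside the $\varepsilon$-extension of $[\alpha,\beta]$ (the union of all $\varepsilon$-balls centred at points of $[\alpha,\beta]$), then $\gamma_n(\varepsilon)/n\to 0$ as $n\to\infty$ through those $n$. In particular, if $T_n(p)$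 is invertible for all sufficiently large $n$, then $\gamma_n(\varepsilon)/n\to0$ as $n\to\infty$. -/

import Mathlib

open MeasureTheory Filter Topology

noncomputable section

/-- Lebesgue measure on the open interval `(-π, π)`. -/
def circleMeasure : Measure ℝ :=
  volume.restrict (Set.Ioo (-Real.pi) Real.pi)

/-- `p` is a trigonometric polynomial with complex coefficients:
`p(x) = ∑_{|k| ≤ d} c_k e^{ikx}` for some `d`. -/
def IsTrigPolynomial (p : ℝ → ℂ) : Prop :=
  ∃ (d : ℕ) (c : ℤ → ℂ), ∀ x : ℝ,
    p x = ∑ k ∈ Finset.Icc (-(d : ℤ)) d, c k * Complex.exp (Complex.I * (k : ℂ) * (x : ℂ))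

/-- The `k`-th Fourier coefficient `(1/2π) ∫_{-π}^{π} g(x) e^{-ikx} dx`. -/
def symbolCoeff (g : ℝ → ℂ) (k : ℤ) : ℂ :=
  (1 / (2 * (Real.pi : ℂ))) *
    ∫ x, g x * Complex.exp (-(Complex.I * (k : ℂ) * (x : ℂ))) ∂circleMeasure

/-- The `n × n` Toeplitz matrix `T_n(g)` generated by `g`: its `(j,k)` entry is the
`(j - k)`-th Fourier coefficient of `g`. -/
def toeplitz (g : ℝ → ℂ) (n : ℕ) : Matrix (Fin n) (Fin n) ℂ :=
  Matrix.of fun j k => symbolCoeff g ((j : ℤ) - (k : ℤ))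

/-- The number, counted with multiplicity, of the `n` singular values of the `n × n` matrix `A`
that lie outside the `ε`-extension of `Φ` (the union of the `ε`-balls centred at points of `Φ`). -/
def singularValueOutliers {n : ℕ} (A : Matrix (Fin n) (Fin n) ℂ) (Φ : Set ℝ) (ε : ℝ) : ℕ :=
  Set.ncard {i : Fin n | A.toEuclideanLin.singularValues (i : ℕ) ∉ Metric.thickening ε Φ}

/-- `Φ` is a general cluster for the singular values of the sequence of matrices `A n`, where `n`
runs through the set of orders `N`: for every `ε > 0` the number of outliers, divided by `n`,
tends to `0` as `n → ∞` within `N`. For `N = Set.univ` this is the notion for a full sequence. -/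
def IsGeneralSingularValueCluster (N : Set ℕ) (A : ∀ n : ℕ, Matrix (Fin n) (Fin n) ℂ)
    (Φ : Set ℝ) : Prop :=
  ∀ ε : ℝ, 0 < ε →
    Tendsto (fun n : ℕ => (singularValueOutliers (A n) Φ ε : ℝ) / (n : ℝ))
      (atTop ⊓ 𝓟 N) (𝓝 0)

end

/-!
Put `h = f / p`, so that `α ≤ ‖h‖ ≤ β` almost everywhere and `f = h * p`. Since `p` is a
trigonometric polynomial of some degree `d`, the matrices `T_n(f)` and `T_n(p) T_n(h)` differ only in
the first `d` and the last `d` rows, whence `T_n(p)⁻¹ T_n(f)` agrees with `T_n(h)` on a subspace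
of codimension at most `2 d` (`exists_submodule_toeplitz_mulVec_eq`). It remains to see that
`T_n(h)` has no singular value above `β` and only `o(n)` below `α - ε`, and that this information
survives the restriction to such a subspace.

Identify `v : ℂⁿ` with `u(x) = ∑ v_k e^{ikx}`. By Parseval, multiplication by `h` stretches norms by
a factor between `α` and `β` (`hasSum_sq_norm_sum_symbolCoeff`), and `T_n(h) v` consists of the
Fourier coefficients of `h u` with index in the window `[0, n)`. So `‖T_n(h) v‖ ≤ β ‖v‖`. If on the
other hand `‖T_n(h) v‖ ≤ (α - ε) ‖v‖`, then the coefficients of `h u` outside the window carry at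
least the proportion `α² - (α - ε)²` of `‖v‖²`. The map sending `v` to those outer coefficients has
squared Hilbert–Schmidt norm `∑_m |h_m|² min(|m|, n)`, where `h_m` are the Fourier coefficients of
`h`, and this is `o(n)` by dominated convergence (`tendsto_tsum_offWindow_div`). By Bessel's
inequality it bounds the dimension of every subspace on which the outer coefficients carry a fixed
proportion of the norm (`finrank_mul_le_tsum_sq_norm`). `singularValueOutliers_le` combines these
bounds into a count of the outliers.
-/

/-! ### Singular values and subspaces -/

open Module in
/-- The orthonormal basis is an eigenbasis of `T* T`, numbered like the singular values of `T`. -/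
theorem LinearMap.exists_orthonormalBasis_sq_norm_apply {E F : Type*}
    [NormedAddCommGroup E] [InnerProductSpace ℂ E] [FiniteDimensional ℂ E]
    [NormedAddCommGroup F] [InnerProductSpace ℂ F] [FiniteDimensional ℂ F]
    (T : E →ₗ[ℂ] F) {n : ℕ} (hn : finrank ℂ E = n) :
    ∃ b : OrthonormalBasis (Fin n) ℂ E,
      ∀ v, ‖T v‖ ^ 2 = ∑ i : Fin n, T.singularValues i ^ 2 * ‖b.repr v i‖ ^ 2 := by
  refine ⟨T.isSymmetric_adjoint_comp_self.eigenvectorBasis hn, fun v => ?_⟩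
  set b := T.isSymmetric_adjoint_comp_self.eigenvectorBasis hn
  have h1 : ((‖T v‖ ^ 2 : ℝ) : ℂ) = inner ℂ v ((LinearMap.adjoint T ∘ₗ T) v) := by
    rw [LinearMap.comp_apply, LinearMap.adjoint_inner_right, inner_self_eq_norm_sq_to_K]
    simp
  have h2 := b.sum_inner_mul_inner v ((LinearMap.adjoint T ∘ₗ T) v)
  rw [← h1] at h2
  apply Complex.ofReal_injective
  rw [← h2, Complex.ofReal_sum]
  refine Finset.sum_congr rfl fun i _ => ?_
  rw [← b.repr_apply_apply, T.isSymmetric_adjoint_comp_self.eigenvectorBasis_apply_self_apply hn v i,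
    ← T.sq_singularValues_fin hn i, ← inner_conj_symm, ← b.repr_apply_apply]
  push_cast
  rw [← Complex.mul_conj']
  simp
  ring

open Module in
/-- `U` is spanned by the right singular vectors with index in `S`. Both estimates are stated with the
squares of the singular values, so that no sign condition on the bound is needed. -/
theorem LinearMap.exists_submodule_of_singularValues_mem {n : ℕ}
    (T : EuclideanSpace ℂ (Fin n) →ₗ[ℂ] EuclideanSpace ℂ (Fin n)) (S : Finset (Fin n)) :
    ∃ U : Submodule ℂ (EuclideanSpace ℂ (Fin n)), finrank ℂ U = S.card ∧
      (∀ t, (∀ i ∈ S, t ≤ T.singularValues i ^ 2) → ∀ v ∈ U, t * ‖v‖ ^ 2 ≤ ‖T v‖ ^ 2) ∧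
      (∀ t, (∀ i ∈ S, T.singularValues i ^ 2 ≤ t) → ∀ v ∈ U, ‖T v‖ ^ 2 ≤ t * ‖v‖ ^ 2) := by
  obtain ⟨b, hb⟩ := T.exists_orthonormalBasis_sq_norm_apply (n := n) (by simp)
  have hli : LinearIndependent ℂ (fun i : S => b i) :=
    b.orthonormal.linearIndependent.comp _ Subtype.val_injective
  have key : ∀ v ∈ Submodule.span ℂ (Set.range fun i : S => b i), ∀ j ∉ S, b.repr v j = 0 := by
    intro v hv j hj
    induction hv using Submodule.span_induction with
    | mem x hx =>
      obtain ⟨i, rfl⟩ := hx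
      have : j ≠ (i : Fin n) := fun h => hj (h ▸ i.2)
      simp [this]
    | zero => simp
    | add x y _ _ hx hy => simp [hx, hy]
    | smul a x _ hx => simp [hx]
  have hnorm : ∀ v, ‖v‖ ^ 2 = ∑ i, ‖b.repr v i‖ ^ 2 := fun v => by
    rw [← b.repr.norm_map v, EuclideanSpace.norm_sq_eq]
  refine ⟨Submodule.span ℂ (Set.range fun i : S => b i), ?_, fun t ht v hv => ?_,
    fun t ht v hv => ?_⟩
  · rw [finrank_span_eq_card hli, Fintype.card_coe]
  all_goals
    rw [hb, hnorm, Finset.mul_sum]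
    refine Finset.sum_le_sum fun i _ => ?_
    by_cases hi : i ∈ S
    · exact mul_le_mul_of_nonneg_right (ht i hi) (by positivity)
    · simp [key v hv i hi]

open Module in
/-- If an operator with rows `r l` satisfies `c ‖v‖² ≤ ‖r v‖²` on `V`, then `c * dim V` is at most
its squared Hilbert–Schmidt norm: sum the inequality over an orthonormal basis of `V` and apply
Bessel's inequality to each row. -/
theorem finrank_mul_le_tsum_sq_norm {n : ℕ} {ι : Type*} (r : ι → Fin n → ℂ)
    (hr : ∀ k, Summable fun l => ‖r l k‖ ^ 2)
    (V : Submodule ℂ (EuclideanSpace ℂ (Fin n))) (c : ℝ)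
    (hV : ∀ v ∈ V, c * ‖v‖ ^ 2 ≤ ∑' l, ‖∑ k, r l k * v k‖ ^ 2) :
    c * finrank ℂ V ≤ ∑' l, ∑ k, ‖r l k‖ ^ 2 := by
  let b := stdOrthonormalBasis ℂ V
  have hon : Orthonormal ℂ fun i => (b i : EuclideanSpace ℂ (Fin n)) :=
    b.orthonormal.comp_linearIsometry V.subtypeₗᵢ
  let R : ι → EuclideanSpace ℂ (Fin n) := fun l => WithLp.toLp 2 fun k => star (r l k)
  have hR : ∀ l, ‖R l‖ ^ 2 = ∑ k, ‖r l k‖ ^ 2 := fun l => by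
    simp [EuclideanSpace.norm_sq_eq, R]
  have hin : ∀ l (v : EuclideanSpace ℂ (Fin n)), ∑ k, r l k * v k = inner ℂ (R l) v := fun l v => by
    simp [PiLp.inner_apply, R, mul_comm]
  have hs : Summable fun l => ‖R l‖ ^ 2 := by
    simp_rw [hR]; exact summable_sum fun k _ => hr k
  have hs' : ∀ v : EuclideanSpace ℂ (Fin n), Summable fun l => ‖inner ℂ (R l) v‖ ^ 2 := fun v => by
    refine Summable.of_nonneg_of_le (fun _ => by positivity) (fun l => ?_) (hs.mul_right (‖v‖ ^ 2))
    rw [← mul_pow]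
    exact pow_le_pow_left₀ (norm_nonneg _) (norm_inner_le_norm _ _) 2
  calc c * finrank ℂ V = ∑ i, c * ‖(b i : EuclideanSpace ℂ (Fin n))‖ ^ 2 := by
        simp [hon.1, mul_comm]
    _ ≤ ∑ i, ∑' l, ‖inner ℂ (R l) (b i : EuclideanSpace ℂ (Fin n))‖ ^ 2 := by
        refine Finset.sum_le_sum fun i _ => ?_
        simpa only [hin] using hV _ (b i).2
    _ = ∑' l, ∑ i, ‖inner ℂ (R l) (b i : EuclideanSpace ℂ (Fin n))‖ ^ 2 :=
        (Summable.tsum_finsetSum fun i _ => hs' _).symm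
    _ ≤ ∑' l, ‖R l‖ ^ 2 := by
        refine Summable.tsum_le_tsum (fun l => ?_) (summable_sum fun i _ => hs' _) hs
        simpa only [norm_inner_symm] using hon.sum_inner_products_le (R l) (s := Finset.univ)
    _ = _ := by simp_rw [hR]

open Module in
theorem Submodule.finrank_le_finrank_inf_add {E : Type*} [AddCommGroup E] [Module ℂ E]
    [FiniteDimensional ℂ E] (U K : Submodule ℂ E) {q : ℕ}
    (hK : finrank ℂ E ≤ finrank ℂ K + q) :
    finrank ℂ U ≤ finrank ℂ (U ⊓ K : Submodule ℂ E) + q := by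
  have := Submodule.finrank_sup_add_finrank_inf_eq U K
  have := (U ⊔ K).finrank_le
  omega

theorem Metric.le_or_le_of_notMem_thickening_Icc {α β ε x : ℝ} (hε : 0 < ε) (hαβ : α ≤ β)
    (hx : x ∉ Metric.thickening ε (Set.Icc α β)) : x ≤ α - ε ∨ β + ε ≤ x := by
  by_contra! h
  apply hx
  rw [Metric.mem_thickening_iff]
  rcases le_total x α with h1 | h1
  · exact ⟨α, ⟨le_rfl, hαβ⟩, by rw [Real.dist_eq, abs_lt]; constructor <;> linarith⟩
  rcases le_total x β with h2 | h2
  · exact ⟨x, ⟨h1, h2⟩, by simpa⟩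
  · exact ⟨β, ⟨hαβ, le_rfl⟩, by rw [Real.dist_eq, abs_lt]; constructor <;> linarith⟩

open Module in
/-- A count of outliers from estimates on a subspace `K` of codimension at most `q`. An upper outlier
would contradict `hup` on `K`, so there are at most `q` of them. On the intersection of `K` with
the span of the singular vectors of the lower outliers, `hlow` forces the rows `r` to carry a fixed
proportion of the norm, so the dimension of that intersection is controlled by `r`. -/
theorem singularValueOutliers_le {n q : ℕ} (A : Matrix (Fin n) (Fin n) ℂ)
    {α β ε : ℝ} (hα : 0 < α) (hαβ : α ≤ β) (hε : 0 < ε)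
    (r : ℤ → Fin n → ℂ) (hr : ∀ k, Summable fun l => ‖r l k‖ ^ 2)
    (K : Submodule ℂ (EuclideanSpace ℂ (Fin n))) (hK : n ≤ finrank ℂ K + q)
    (hup : ∀ v ∈ K, ‖A.toEuclideanLin v‖ ^ 2 ≤ β ^ 2 * ‖v‖ ^ 2)
    (hlow : ∀ v ∈ K,
      α ^ 2 * ‖v‖ ^ 2 ≤ ‖A.toEuclideanLin v‖ ^ 2 + ∑' l, ‖∑ k, r l k * v k‖ ^ 2) :
    (singularValueOutliers A (Set.Icc α β) ε : ℝ) ≤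
      2 * q + (∑' l, ∑ k, ‖r l k‖ ^ 2) / (α ^ 2 - (max (α - ε) 0) ^ 2) := by
  classical
  set T := A.toEuclideanLin
  -- For `ε > α` there are no lower outliers, and the truncation at `0` keeps `hc` true.
  have hc : 0 < α ^ 2 - (max (α - ε) 0) ^ 2 := by
    have h0 : 0 ≤ max (α - ε) 0 := le_max_right _ _
    have h1 : max (α - ε) 0 < α := max_lt (by linarith) hα
    nlinarith
  set S₁ : Finset (Fin n) := {i | T.singularValues i ≤ α - ε}
  set S₂ : Finset (Fin n) := {i | β + ε ≤ T.singularValues i}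
  have hcount : singularValueOutliers A (Set.Icc α β) ε ≤ S₁.card + S₂.card := by
    refine le_trans ?_ (Finset.card_union_le S₁ S₂)
    rw [← Set.ncard_coe_finset]
    refine Set.ncard_le_ncard (fun i hi => ?_) (Finset.finite_toSet _)
    simpa [S₁, S₂] using Metric.le_or_le_of_notMem_thickening_Icc hε hαβ hi
  have h₂ : S₂.card ≤ q := by
    obtain ⟨U, hU, hlo, -⟩ := T.exists_submodule_of_singularValues_mem S₂
    have := U.finrank_le_finrank_inf_add K (q := q) (by simpa using hK)
    have hbot : U ⊓ K = ⊥ := by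
      rw [eq_bot_iff]
      rintro v ⟨hvU, hvK⟩
      have h1 := hlo ((β + ε) ^ 2) (fun i hi => by
        have : β + ε ≤ T.singularValues i := by simpa [S₂] using hi
        gcongr
        linarith) v hvU
      have h2 := hup v hvK
      have h3 : ((β + ε) ^ 2 - β ^ 2) * ‖v‖ ^ 2 ≤ 0 := by linarith
      have h4 : 0 < (β + ε) ^ 2 - β ^ 2 := by nlinarith
      have h5 : ‖v‖ ^ 2 ≤ 0 := by
        by_contra! h
        nlinarith [mul_pos h4 h]
      have h6 : ‖v‖ = 0 := by
        have := sq_nonneg ‖v‖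
        exact pow_eq_zero_iff (two_ne_zero) |>.1 (le_antisymm h5 this)
      simpa using h6
    rw [hbot, finrank_bot] at this
    omega
  have h₁ : (S₁.card : ℝ) ≤
      q + (∑' l, ∑ k, ‖r l k‖ ^ 2) / (α ^ 2 - (max (α - ε) 0) ^ 2) := by
    obtain ⟨U, hU, -, hhi⟩ := T.exists_submodule_of_singularValues_mem S₁
    have := U.finrank_le_finrank_inf_add K (q := q) (by simpa using hK)
    have h1 := finrank_mul_le_tsum_sq_norm r hr (U ⊓ K) (α ^ 2 - (max (α - ε) 0) ^ 2) (by
      rintro v ⟨hvU, hvK⟩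
      have h1 := hhi ((max (α - ε) 0) ^ 2) (fun i hi => by
        have : T.singularValues i ≤ α - ε := by simpa [S₁] using hi
        exact pow_le_pow_left₀ (T.singularValues_nonneg _) (this.trans (le_max_left _ _)) 2) v hvU
      have h2 := hlow v hvK
      linarith)
    have h2 : (finrank ℂ (U ⊓ K : Submodule ℂ _) : ℝ) ≤
        (∑' l, ∑ k, ‖r l k‖ ^ 2) / (α ^ 2 - (max (α - ε) 0) ^ 2) := by
      rwa [le_div_iff₀ hc, mul_comm]
    have h3 : (S₁.card : ℝ) ≤ finrank ℂ (U ⊓ K : Submodule ℂ _) + q := by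
      rw [hU] at this
      exact_mod_cast this
    linarith
  have : (singularValueOutliers A (Set.Icc α β) ε : ℝ) ≤ S₁.card + S₂.card := by
    exact_mod_cast hcount
  have h₂' : (S₂.card : ℝ) ≤ q := by exact_mod_cast h₂
  linarith

/-! ### Fourier coefficients on `(-π, π)` -/

instance : IsFiniteMeasure circleMeasure := by
  unfold circleMeasure; infer_instance

theorem circleMeasure_eq_restrict_Ioc :
    circleMeasure = volume.restrict (Set.Ioc (-Real.pi) Real.pi) :=
  restrict_Ioo_eq_restrict_Ioc

theorem neg_pi_lt_pi : -Real.pi < Real.pi := by linarith [Real.pi_pos]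

theorem symbolCoeff_eq_fourierCoeffOn (g : ℝ → ℂ) (k : ℤ) :
    symbolCoeff g k = fourierCoeffOn neg_pi_lt_pi g k := by
  rw [fourierCoeffOn_eq_integral, symbolCoeff, circleMeasure_eq_restrict_Ioc,
    intervalIntegral.integral_of_le neg_pi_lt_pi.le, ← Complex.coe_smul, smul_eq_mul]
  congr 1
  · push_cast; ring
  · refine integral_congr_ae (ae_of_all _ fun x => ?_)
    simp only [fourier_coe_apply, smul_eq_mul]
    rw [mul_comm]
    congr 2
    have : (Real.pi : ℂ) ≠ 0 := by exact_mod_cast Real.pi_ne_zero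
    push_cast
    field_simp
    ring

/-- Parseval's identity. -/
theorem hasSum_sq_norm_symbolCoeff {g : ℝ → ℂ} (hg : MemLp g 2 circleMeasure) :
    HasSum (fun k => ‖symbolCoeff g k‖ ^ 2)
      ((2 * Real.pi)⁻¹ * ∫ x, ‖g x‖ ^ 2 ∂circleMeasure) := by
  have := hasSum_sq_fourierCoeffOn neg_pi_lt_pi (circleMeasure_eq_restrict_Ioc ▸ hg)
  simp_rw [← symbolCoeff_eq_fourierCoeffOn] at this
  rw [intervalIntegral.integral_of_le neg_pi_lt_pi.le, ← circleMeasure_eq_restrict_Ioc,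
    smul_eq_mul] at this
  convert this using 3
  ring

theorem norm_exp_I_mul_intCast_mul (k : ℤ) (x : ℝ) :
    ‖Complex.exp (Complex.I * (k : ℂ) * (x : ℂ))‖ = 1 := by
  rw [show Complex.I * (k : ℂ) * (x : ℂ) = ((k * x : ℝ) : ℂ) * Complex.I by push_cast; ring]
  exact Complex.norm_exp_ofReal_mul_I _

theorem symbolCoeff_mul_exp (h : ℝ → ℂ) (m l : ℤ) :
    symbolCoeff (fun x => h x * Complex.exp (Complex.I * (m : ℂ) * (x : ℂ))) l =
      symbolCoeff h (l - m) := by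
  unfold symbolCoeff
  congr 2
  ext x
  rw [mul_assoc, ← Complex.exp_add]
  congr 2
  push_cast
  ring

theorem MeasureTheory.Integrable.mul_exp_I {h : ℝ → ℂ} {μ : Measure ℝ} (hh : Integrable h μ) (m : ℤ) :
    Integrable (fun x => h x * Complex.exp (Complex.I * (m : ℂ) * (x : ℂ))) μ := by
  refine hh.mul_bdd (c := 1) ?_ (ae_of_all _ fun x => (norm_exp_I_mul_intCast_mul m x).le)
  exact (by fun_prop : Continuous fun x : ℝ =>
    Complex.exp (Complex.I * (m : ℂ) * (x : ℂ))).aestronglyMeasurable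

/-- Multiplication by a trigonometric polynomial acts on Fourier coefficients by convolution. -/
theorem symbolCoeff_mul_sum_exp {ι : Type*} {h : ℝ → ℂ} (hh : Integrable h circleMeasure)
    (s : Finset ι) (c : ι → ℂ) (m : ι → ℤ) (l : ℤ) :
    symbolCoeff (fun x => h x * ∑ i ∈ s, c i * Complex.exp (Complex.I * (m i : ℂ) * (x : ℂ))) l =
      ∑ i ∈ s, symbolCoeff h (l - m i) * c i := by
  simp_rw [← symbolCoeff_mul_exp]
  unfold symbolCoeff
  simp_rw [mul_assoc (1 / (2 * (Real.pi : ℂ))), ← Finset.mul_sum, ← integral_mul_const]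
  rw [← integral_finsetSum]
  · congr 2
    ext x
    rw [Finset.mul_sum, Finset.sum_mul]
    refine Finset.sum_congr rfl fun i _ => ?_
    ring
  · intro i _
    have := ((hh.mul_exp_I (m i)).mul_exp_I (-l)).mul_const (c i)
    convert this using 6
    push_cast
    ring

theorem symbolCoeff_one (l : ℤ) : symbolCoeff (fun _ => 1) l = if l = 0 then 1 else 0 := by
  unfold symbolCoeff
  have hpi : (Real.pi : ℂ) ≠ 0 := by exact_mod_cast Real.pi_ne_zero
  rw [circleMeasure_eq_restrict_Ioc, ← intervalIntegral.integral_of_le neg_pi_lt_pi.le]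
  split_ifs with hl
  · subst hl
    simp
    field_simp
    ring
  · have hc : -(Complex.I * (l : ℂ)) ≠ 0 := by simp [hl]
    have : ∀ x : ℝ, (1 : ℂ) * Complex.exp (-(Complex.I * (l : ℂ) * (x : ℂ))) =
        Complex.exp (-(Complex.I * (l : ℂ)) * x) := fun x => by rw [one_mul]; congr 1; ring
    simp_rw [this]
    rw [integral_exp_mul_complex hc]
    have hper : Complex.exp (-(Complex.I * (l : ℂ)) * ((Real.pi : ℝ) : ℂ)) =
        Complex.exp (-(Complex.I * (l : ℂ)) * ((-Real.pi : ℝ) : ℂ)) := by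
      rw [Complex.exp_eq_exp_iff_exists_int]
      exact ⟨-l, by push_cast; ring⟩
    rw [hper]
    simp

theorem symbolCoeff_sum_exp {ι : Type*} [DecidableEq ι] (s : Finset ι) (c : ι → ℂ) (m : ι → ℤ)
    (l : ℤ) :
    symbolCoeff (fun x => ∑ i ∈ s, c i * Complex.exp (Complex.I * (m i : ℂ) * (x : ℂ))) l =
      ∑ i ∈ s, if l = m i then c i else 0 := by
  have := symbolCoeff_mul_sum_exp (h := fun _ => 1) (integrable_const _) s c m l
  simp_rw [one_mul, symbolCoeff_one] at this
  rw [this]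
  simp [sub_eq_zero]

/-- Parseval's identity for the trigonometric polynomial with coefficient vector `v`. -/
theorem integral_sq_norm_sum_exp {n : ℕ} (v : Fin n → ℂ) :
    (2 * Real.pi)⁻¹ * ∫ x, ‖∑ k, v k * Complex.exp (Complex.I * (((k : ℕ) : ℤ) : ℂ) * (x : ℂ))‖ ^ 2
      ∂circleMeasure = ∑ k, ‖v k‖ ^ 2 := by
  have hL : MemLp (fun x : ℝ => ∑ k, v k * Complex.exp (Complex.I * (((k : ℕ) : ℤ) : ℂ) * (x : ℂ)))
      2 circleMeasure := by
    refine MemLp.of_bound (C := ∑ k, ‖v k‖) (by fun_prop) ?_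
    refine ae_of_all _ fun x => (norm_sum_le _ _).trans_eq ?_
    simp_rw [norm_mul, norm_exp_I_mul_intCast_mul, mul_one]
  have h1 := hasSum_sq_norm_symbolCoeff hL
  simp_rw [symbolCoeff_sum_exp Finset.univ v fun k => ((k : ℕ) : ℤ)] at h1
  refine h1.unique ?_
  have h2 : ∀ l ∉ (Finset.univ : Finset (Fin n)).map
      (Fin.valEmbedding.trans Nat.castEmbedding : Fin n ↪ ℤ),
      ‖∑ k : Fin n, if l = ((k : ℕ) : ℤ) then v k else 0‖ ^ 2 = 0 := by
    intro l hl
    rw [Finset.sum_eq_zero]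
    · simp
    intro k _
    rw [if_neg]
    rintro rfl
    simp at hl
  convert (hasSum_sum_of_ne_finset_zero h2 : HasSum _ _) using 1
  rw [Finset.sum_map]
  refine Finset.sum_congr rfl fun k _ => ?_
  simp [Fin.val_inj]

/-- The sum is over all Fourier coefficients of `h u`, where `u(x) = ∑ v_k e^{ikx}`; its value `I` is
the normalized integral of `‖h u‖²`, to be compared with that of `‖u‖²`, which is `‖v‖²`. -/
theorem hasSum_sq_norm_sum_symbolCoeff {h : ℝ → ℂ} {α β : ℝ} (hα : 0 ≤ α)
    (hm : AEStronglyMeasurable h circleMeasure)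
    (hlo : ∀ᵐ x ∂circleMeasure, α ≤ ‖h x‖) (hhi : ∀ᵐ x ∂circleMeasure, ‖h x‖ ≤ β)
    {n : ℕ} (v : EuclideanSpace ℂ (Fin n)) :
    ∃ I, HasSum (fun l : ℤ => ‖∑ k : Fin n, symbolCoeff h (l - (k : ℤ)) * v k‖ ^ 2) I ∧
      α ^ 2 * ‖v‖ ^ 2 ≤ I ∧ I ≤ β ^ 2 * ‖v‖ ^ 2 := by
  set u : ℝ → ℂ := fun x => ∑ k, v k * Complex.exp (Complex.I * (((k : ℕ) : ℤ) : ℂ) * (x : ℂ))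
  have huc : Continuous u := by fun_prop
  have hub : ∀ x, ‖u x‖ ≤ ∑ k, ‖v k‖ := fun x => by
    refine (norm_sum_le _ _).trans_eq ?_
    simp_rw [norm_mul, norm_exp_I_mul_intCast_mul, mul_one]
  have hh : Integrable h circleMeasure := (MemLp.of_bound (p := 1) hm β hhi).integrable le_rfl
  have hL : MemLp (fun x => h x * u x) 2 circleMeasure := by
    refine MemLp.of_bound (C := β * ∑ k, ‖v k‖) (hm.mul huc.aestronglyMeasurable) ?_
    filter_upwards [hhi] with x hx
    rw [norm_mul]
    exact mul_le_mul hx (hub x) (norm_nonneg _) ((norm_nonneg _).trans hx)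
  have hu : Integrable (fun x => ‖u x‖ ^ 2) circleMeasure :=
    (MemLp.of_bound (p := 2) huc.aestronglyMeasurable _ (ae_of_all _ hub)).integrable_norm_pow
      (by norm_num)
  have hLi : Integrable (fun x => ‖h x * u x‖ ^ 2) circleMeasure :=
    hL.integrable_norm_pow (by norm_num)
  have hv : ‖v‖ ^ 2 = (2 * Real.pi)⁻¹ * ∫ x, ‖u x‖ ^ 2 ∂circleMeasure := by
    rw [integral_sq_norm_sum_exp, EuclideanSpace.norm_sq_eq]
  have hpi : 0 ≤ (2 * Real.pi)⁻¹ := by positivity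
  refine ⟨(2 * Real.pi)⁻¹ * ∫ x, ‖h x * u x‖ ^ 2 ∂circleMeasure, ?_, ?_, ?_⟩
  · have := hasSum_sq_norm_symbolCoeff hL
    simp_rw [u, symbolCoeff_mul_sum_exp hh Finset.univ v.ofLp fun k => ((k : ℕ) : ℤ)] at this
    exact this
  · rw [hv, mul_left_comm, ← integral_const_mul]
    refine mul_le_mul_of_nonneg_left (integral_mono_ae (hu.const_mul _) hLi ?_) hpi
    filter_upwards [hlo] with x hx
    simp only [norm_mul, mul_pow]
    gcongr
  · rw [hv, mul_left_comm, ← integral_const_mul (β ^ 2)]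
    refine mul_le_mul_of_nonneg_left (integral_mono_ae hLi (hu.const_mul _) ?_) hpi
    filter_upwards [hhi] with x hx
    simp only [norm_mul, mul_pow]
    gcongr

/-- With `a m = |h_m|²` the double sum is the squared Hilbert–Schmidt norm of the map from a vector
`v : ℂⁿ` to the coefficients of `h u` outside the window `[0, n)`. Substituting `m = l - k`, the
term `a m` occurs for those `k < n` with `m + k` outside the window; their number is at most `|m|`
and at most `n`, so that dominated convergence applies after division by `n`. -/
theorem tendsto_tsum_offWindow_div {a : ℤ → ℝ} (ha0 : ∀ m, 0 ≤ a m) (ha : Summable a) :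
    Tendsto (fun n : ℕ => (∑' l : ℤ, ∑ k : Fin n,
      if 0 ≤ l ∧ l < n then 0 else a (l - (k : ℤ))) / n) atTop (𝓝 0) := by
  have hcount : ∀ (n : ℕ) (m : ℤ),
      (Finset.card {k : Fin n | ¬ (0 ≤ m + (k : ℤ) ∧ m + (k : ℤ) < n)}) ≤ m.natAbs := by
    intro n m
    -- `B` is an interval of length `|m|` that contains every index `k` counted.
    let B : Finset ℤ := if 0 ≤ m then Finset.Ico (n - m) n else Finset.Ico 0 (-m)
    have hB : B.card = m.natAbs := by
      simp only [B]; split_ifs <;> simp <;> omega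
    rw [← hB]
    refine Finset.card_le_card_of_injOn (fun k : Fin n => ((k : ℕ) : ℤ)) ?_ ?_
    · intro k hk
      have hk' := k.2
      simp only [Finset.coe_filter, Finset.mem_univ, true_and, Set.mem_ofPred_eq] at hk
      simp only [B]
      split_ifs <;> simp <;> omega
    · intro k _ k' _ hkk
      exact Fin.ext (by simpa using hkk)
  have heq : ∀ n : ℕ, (∑' l : ℤ, ∑ k : Fin n,
      if 0 ≤ l ∧ l < n then 0 else a (l - (k : ℤ))) / n =
      ∑' m : ℤ, (Finset.card {k : Fin n | ¬ (0 ≤ m + (k : ℤ) ∧ m + (k : ℤ) < n)} : ℝ) / n * a m := by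
    intro n
    have hs : ∀ k : Fin n, Summable fun l : ℤ => if 0 ≤ l ∧ l < n then 0 else a (l - (k : ℤ)) := by
      intro k
      refine Summable.of_nonneg_of_le (fun l => ?_) (fun l => ?_)
        ((Equiv.subRight (k : ℤ)).summable_iff.2 ha)
      · split_ifs
        exacts [le_rfl, ha0 _]
      · simp only [Function.comp, Equiv.subRight_apply]
        split_ifs
        exacts [ha0 _, le_rfl]
    have hs2 : ∀ k : Fin n,
        Summable fun m : ℤ => if 0 ≤ m + (k : ℤ) ∧ m + (k : ℤ) < n then 0 else a m := by
      intro k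
      refine Summable.of_nonneg_of_le (fun l => ?_) (fun l => ?_) ha
      · split_ifs
        exacts [le_rfl, ha0 _]
      · split_ifs
        exacts [ha0 _, le_rfl]
    rw [Summable.tsum_finsetSum fun k _ => hs k]
    have hshift : ∀ k : Fin n, (∑' l : ℤ, if 0 ≤ l ∧ l < n then 0 else a (l - (k : ℤ))) =
        ∑' m : ℤ, if 0 ≤ m + (k : ℤ) ∧ m + (k : ℤ) < n then 0 else a m := by
      intro k
      rw [← (Equiv.addRight (k : ℤ)).tsum_eq]
      simp
    simp_rw [hshift]
    rw [← Summable.tsum_finsetSum fun k _ => hs2 k, ← tsum_div_const]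
    refine tsum_congr fun m => ?_
    rw [div_mul_eq_mul_div]
    congr 1
    simp_rw [← ite_not (p := (0 ≤ m + _ ∧ _))]
    rw [← Finset.sum_filter, Finset.sum_const, nsmul_eq_mul]
  simp_rw [heq]
  have := tendsto_tsum_of_dominated_convergence (𝓕 := (atTop : Filter ℕ)) (bound := a)
    (f := fun (n : ℕ) (m : ℤ) =>
      (Finset.card {k : Fin n | ¬ (0 ≤ m + (k : ℤ) ∧ m + (k : ℤ) < n)} : ℝ) / n * a m)
    (g := fun _ => 0) ha ?_ ?_
  · simpa using this
  · intro m
    rw [← zero_mul (a m)]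
    refine Tendsto.mul_const _ ?_
    refine squeeze_zero (fun n => by positivity) (fun n => ?_)
      (tendsto_const_div_atTop_nhds_zero_nat (m.natAbs : ℝ))
    gcongr
    exact hcount n m
  · refine Eventually.of_forall fun n m => ?_
    rw [Real.norm_of_nonneg (mul_nonneg (by positivity) (ha0 m))]
    refine mul_le_of_le_one_left (ha0 m) (div_le_one_of_le₀ ?_ (by positivity))
    exact_mod_cast (Finset.card_le_univ _).trans_eq (Fintype.card_fin n)

/-! ### Toeplitz matrices -/

theorem IsTrigPolynomial.continuous {p : ℝ → ℂ} (hp : IsTrigPolynomial p) : Continuous p := by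
  obtain ⟨d, c, hc⟩ := hp
  rw [funext hc]
  fun_prop

/-- In a row at distance at least `d` from both ends, the band of `T_n(p)` is not cut off, and the
matrix product is the full convolution of the Fourier coefficients of `p` and `h`. -/
theorem toeplitz_mul_toeplitz_apply_of_interior {f h : ℝ → ℂ} (hh : Integrable h circleMeasure)
    {d : ℕ} {c : ℤ → ℂ} {p : ℝ → ℂ}
    (hp : ∀ x : ℝ,
      p x = ∑ k ∈ Finset.Icc (-(d : ℤ)) d, c k * Complex.exp (Complex.I * (k : ℂ) * (x : ℂ)))
    (hf : f =ᵐ[circleMeasure] fun x => h x * p x) {n : ℕ} {j : Fin n}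
    (hj : d ≤ (j : ℕ) ∧ (j : ℕ) + d < n) (k : Fin n) :
    (toeplitz p n * toeplitz h n) j k = toeplitz f n j k := by
  have hfc : ∀ l, symbolCoeff f l =
      ∑ q ∈ Finset.Icc (-(d : ℤ)) d, symbolCoeff h (l - q) * c q := by
    intro l
    refine Eq.trans ?_ (symbolCoeff_mul_sum_exp hh _ c id l)
    unfold symbolCoeff
    congr 1
    refine integral_congr_ae ?_
    filter_upwards [hf] with x hx
    rw [hx, hp]
    rfl
  have hpc : ∀ l, symbolCoeff p l = ∑ q ∈ Finset.Icc (-(d : ℤ)) d, if l = q then c q else 0 := by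
    intro l
    rw [funext hp]
    exact symbolCoeff_sum_exp _ c id l
  simp only [Matrix.mul_apply, toeplitz, Matrix.of_apply, hpc, hfc, Finset.sum_mul]
  rw [Finset.sum_comm]
  refine Finset.sum_congr rfl fun q hq => ?_
  rw [Finset.mem_Icc] at hq
  have hlt : ((j : ℤ) - q).toNat < n := by omega
  rw [Finset.sum_eq_single ⟨((j : ℤ) - q).toNat, hlt⟩]
  · have : ((((j : ℤ) - q).toNat : ℕ) : ℤ) = j - q := by omega
    simp only [this]
    rw [if_pos (by ring), mul_comm]
    congr 2
    ring
  · intro l _ hl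
    rw [if_neg, zero_mul]
    intro h
    apply hl
    ext
    simp only
    omega
  · simp

open Module in
/-- Outside the boundary rows, `T_n(f)` and `T_n(p) T_n(h)` coincide; `K` is the set of vectors on
which the boundary rows agree as well, and `q = 2 d` is independent of `n`. -/
theorem exists_submodule_toeplitz_mulVec_eq {f h p : ℝ → ℂ} (hh : Integrable h circleMeasure)
    (hp : IsTrigPolynomial p) (hf : f =ᵐ[circleMeasure] fun x => h x * p x) :
    ∃ q : ℕ, ∀ n : ℕ, ∃ K : Submodule ℂ (EuclideanSpace ℂ (Fin n)), n ≤ finrank ℂ K + q ∧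
      ∀ v ∈ K, (toeplitz f n).mulVec v.ofLp =
        (toeplitz p n).mulVec ((toeplitz h n).mulVec v.ofLp) := by
  obtain ⟨d, c, hc⟩ := hp
  refine ⟨d + d, fun n => ?_⟩
  let D := toeplitz f n - toeplitz p n * toeplitz h n
  let B : Finset (Fin n) := {j | ¬ (d ≤ (j : ℕ) ∧ (j : ℕ) + d < n)}
  have hB : B.card ≤ d + d := by
    have h1 : B.card ≤ (Finset.range d ∪ Finset.Ico (n - d) n).card := by
      refine Finset.card_le_card_of_injOn Fin.val (fun j hj => ?_) Fin.val_injective.injOn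
      have hj' := j.2
      simp only [B, Finset.coe_filter, Finset.mem_univ, true_and, Set.mem_ofPred_eq] at hj
      simp
      omega
    refine h1.trans ((Finset.card_union_le _ _).trans ?_)
    rw [Finset.card_range, Nat.card_Ico]
    omega
  let φ : EuclideanSpace ℂ (Fin n) →ₗ[ℂ] (B → ℂ) :=
    LinearMap.funLeft ℂ ℂ (Subtype.val : B → Fin n) ∘ₗ D.mulVecLin ∘ₗ
      (WithLp.linearEquiv 2 ℂ (Fin n → ℂ)).toLinearMap
  refine ⟨LinearMap.ker φ, ?_, fun v hv => ?_⟩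
  · have h1 := φ.finrank_range_add_finrank_ker
    have h2 := (LinearMap.range φ).finrank_le
    simp only [finrank_euclideanSpace, Fintype.card_fin] at h1
    simp only [finrank_fintype_fun_eq_card, Fintype.card_coe] at h2
    omega
  · rw [Matrix.mulVec_mulVec, ← sub_eq_zero, ← Matrix.sub_mulVec]
    ext j
    by_cases hj : j ∈ B
    · exact congrFun (LinearMap.mem_ker.1 hv) ⟨j, hj⟩
    · have hj' : d ≤ (j : ℕ) ∧ (j : ℕ) + d < n := by
        by_contra h
        exact hj (by simpa [B] using h)
      simp only [Matrix.mulVec, dotProduct, Pi.zero_apply]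
      refine Finset.sum_eq_zero fun k _ => ?_
      rw [Matrix.sub_apply, toeplitz_mul_toeplitz_apply_of_interior hh hc hf hj', sub_self,
        zero_mul]

/-- The Fourier coefficients of `h u` split into those in the window `[0, n)`, which are the entries
of `T_n(h) v`, and those outside. -/
theorem sq_norm_toeplitz_add_tsum {h : ℝ → ℂ} {n : ℕ} (v : EuclideanSpace ℂ (Fin n)) {I : ℝ}
    (hI : HasSum (fun l : ℤ => ‖∑ k : Fin n, symbolCoeff h (l - (k : ℤ)) * v k‖ ^ 2) I) :
    ‖(toeplitz h n).toEuclideanLin v‖ ^ 2 + ∑' l : ℤ, ‖∑ k : Fin n,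
      (if 0 ≤ l ∧ l < n then 0 else symbolCoeff h (l - (k : ℤ))) * v k‖ ^ 2 = I := by
  have h1 : HasSum (fun l : ℤ => if 0 ≤ l ∧ l < n then
      ‖∑ k : Fin n, symbolCoeff h (l - (k : ℤ)) * v k‖ ^ 2 else 0)
      (‖(toeplitz h n).toEuclideanLin v‖ ^ 2) := by
    have h2 : ∀ l ∉ (Finset.univ : Finset (Fin n)).map
        (Fin.valEmbedding.trans Nat.castEmbedding : Fin n ↪ ℤ), (if 0 ≤ l ∧ l < n then
      ‖∑ k : Fin n, symbolCoeff h (l - (k : ℤ)) * v k‖ ^ 2 else 0) = 0 := by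
      intro l hl
      rw [if_neg]
      rintro ⟨h0, hn⟩
      exact hl (Finset.mem_map.2 ⟨⟨l.toNat, by omega⟩, Finset.mem_univ _, by simp [h0]⟩)
    convert (hasSum_sum_of_ne_finset_zero h2 : HasSum _ _) using 1
    rw [Finset.sum_map, EuclideanSpace.norm_sq_eq]
    refine Finset.sum_congr rfl fun j _ => ?_
    simp [Matrix.toLpLin_apply, Matrix.mulVec, dotProduct, toeplitz]
  have h3 := (hI.sub h1).tsum_eq
  rw [← eq_sub_iff_add_eq', ← h3]
  refine tsum_congr fun l => ?_
  split_ifs <;> simp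

theorem summable_sq_norm_offWindow {h : ℝ → ℂ} (hh : MemLp h 2 circleMeasure) (n : ℕ)
    (k : Fin n) :
    Summable fun l : ℤ => ‖(if 0 ≤ l ∧ l < n then 0 else symbolCoeff h (l - (k : ℤ)))‖ ^ 2 := by
  refine Summable.of_nonneg_of_le (fun l => by positivity) (fun l => ?_)
    ((Equiv.subRight (k : ℤ)).summable_iff.2 (hasSum_sq_norm_symbolCoeff hh).summable)
  simp only [Function.comp, Equiv.subRight_apply]
  split_ifs
  · simp
  · rfl

/-- The cluster property for `L^∞` bounds on `f / p`. The lower bound also excludes zeros of `p`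
outside a null set, since `f x / 0 = 0`. -/
theorem isGeneralSingularValueCluster_of_bounds {f p : ℝ → ℂ} {α β : ℝ}
    (hp : IsTrigPolynomial p) (hα : 0 < α) (hαβ : α ≤ β)
    (hm : AEStronglyMeasurable f circleMeasure)
    (hlo : ∀ᵐ x ∂circleMeasure, α ≤ ‖f x / p x‖)
    (hhi : ∀ᵐ x ∂circleMeasure, ‖f x / p x‖ ≤ β) :
    IsGeneralSingularValueCluster {n : ℕ | IsUnit (toeplitz p n).det}
      (fun n => (toeplitz p n)⁻¹ * toeplitz f n) (Set.Icc α β) := by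
  intro ε hε
  set h : ℝ → ℂ := fun x => f x / p x
  have hmh : AEStronglyMeasurable h circleMeasure :=
    (hm.aemeasurable.div hp.continuous.measurable.aemeasurable).aestronglyMeasurable
  have hL : MemLp h 2 circleMeasure := MemLp.of_bound hmh β hhi
  have hfh : f =ᵐ[circleMeasure] fun x => h x * p x := by
    filter_upwards [hlo] with x hx
    have : p x ≠ 0 := by
      intro h0
      simp only [h0, div_zero, norm_zero] at hx
      linarith
    simp [h, this]
  obtain ⟨q, hq⟩ := exists_submodule_toeplitz_mulVec_eq (hL.integrable one_le_two) hp hfh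
  have hbound : ∀ n ∈ {n : ℕ | IsUnit (toeplitz p n).det},
      (singularValueOutliers ((toeplitz p n)⁻¹ * toeplitz f n) (Set.Icc α β) ε : ℝ) / n ≤
      (2 * q : ℝ) / n + (∑' l : ℤ, ∑ k : Fin n,
        if 0 ≤ l ∧ l < n then 0 else ‖symbolCoeff h (l - (k : ℤ))‖ ^ 2) / n /
          (α ^ 2 - (max (α - ε) 0) ^ 2) := by
    intro n hn
    obtain ⟨K, hK, hKv⟩ := hq n
    have hX : ∀ v ∈ K, ((toeplitz p n)⁻¹ * toeplitz f n).toEuclideanLin v =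
        (toeplitz h n).toEuclideanLin v := by
      intro v hv
      rw [Matrix.toLpLin_apply, Matrix.toLpLin_apply, ← Matrix.mulVec_mulVec, hKv v hv,
        Matrix.mulVec_mulVec, Matrix.nonsing_inv_mul _ hn, Matrix.one_mulVec]
    have main := singularValueOutliers_le ((toeplitz p n)⁻¹ * toeplitz f n) hα hαβ hε
      (fun l k => if 0 ≤ l ∧ l < n then 0 else symbolCoeff h (l - (k : ℤ)))
      (summable_sq_norm_offWindow hL n) K hK
      (fun v hv => by
        obtain ⟨I, hI, -, hI2⟩ := hasSum_sq_norm_sum_symbolCoeff hα.le hmh hlo hhi v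
        rw [hX v hv]
        have := sq_norm_toeplitz_add_tsum v hI
        have h0 : 0 ≤ ∑' l : ℤ, ‖∑ k : Fin n,
          (if 0 ≤ l ∧ l < n then 0 else symbolCoeff h (l - (k : ℤ))) * v k‖ ^ 2 :=
          tsum_nonneg fun l => by positivity
        linarith)
      (fun v hv => by
        obtain ⟨I, hI, hI1, -⟩ := hasSum_sq_norm_sum_symbolCoeff hα.le hmh hlo hhi v
        rw [hX v hv]
        exact hI1.trans (sq_norm_toeplitz_add_tsum v hI).ge)
    refine (div_le_div_of_nonneg_right main n.cast_nonneg).trans_eq ?_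
    rw [add_div, div_right_comm]
    simp only [apply_ite norm, norm_zero, ite_pow, ne_eq, OfNat.ofNat_ne_zero, not_false_eq_true,
      zero_pow]
  refine tendsto_of_tendsto_of_tendsto_of_le_of_le' tendsto_const_nhds
    (h := fun n : ℕ => (2 * q : ℝ) / n + (∑' l : ℤ, ∑ k : Fin n,
        if 0 ≤ l ∧ l < n then 0 else ‖symbolCoeff h (l - (k : ℤ))‖ ^ 2) / n /
          (α ^ 2 - (max (α - ε) 0) ^ 2)) ?_
    (Eventually.of_forall fun n => by positivity)
    (eventually_inf_principal.2 (Eventually.of_forall hbound))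
  refine Tendsto.mono_left ?_ inf_le_left
  simpa using (tendsto_const_div_atTop_nhds_zero_nat (2 * q : ℝ)).add
    ((tendsto_tsum_offWindow_div (fun _ => by positivity)
      (hasSum_sq_norm_symbolCoeff hL).summable).div_const _)

theorem theorem2p1p1 (f p : ℝ → ℂ) (α β : ℝ)
    (hf : MemLp f 2 circleMeasure)
    (hp : IsTrigPolynomial p)
    (hre : ∀ᵐ x ∂circleMeasure, 0 < (f x / p x).re)
    (hα : 0 < α)
    (hinf : essInf (fun x => ‖f x / p x‖ₑ) circleMeasure = ENNReal.ofReal α)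
    (hsup : essSup (fun x => ‖f x / p x‖ₑ) circleMeasure = ENNReal.ofReal β) :
    IsGeneralSingularValueCluster {n : ℕ | IsUnit (toeplitz p n).det}
      (fun n => (toeplitz p n)⁻¹ * toeplitz f n) (Set.Icc α β) := by
  have hlo : ∀ᵐ x ∂circleMeasure, α ≤ ‖f x / p x‖ := by
    filter_upwards [ae_essInf_le (f := fun x => ‖f x / p x‖ₑ) (μ := circleMeasure)] with x hx
    rwa [hinf, ← ofReal_norm, ENNReal.ofReal_le_ofReal_iff (norm_nonneg _)] at hx
  -- `ENNReal.ofReal` truncates a negative `β`, which is excluded below with the help of `hlo`.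
  have hhi' : ∀ᵐ x ∂circleMeasure, ‖f x / p x‖ ≤ max β 0 := by
    filter_upwards [ENNReal.ae_le_essSup fun x => ‖f x / p x‖ₑ] with x hx
    rw [hsup, ← ofReal_norm] at hx
    exact le_max_iff.2 (ENNReal.ofReal_le_ofReal_iff'.1 hx)
  have hne : NeZero circleMeasure := ⟨by
    rw [circleMeasure, Ne, Measure.restrict_eq_zero, Real.volume_Ioo]
    simpa using Real.pi_pos⟩
  obtain ⟨x, hx1, hx2⟩ := (hlo.and hhi').exists
  have hβ : max β 0 = β := max_eq_left (by
    by_contra! hb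
    rw [max_eq_right hb.le] at hx2
    linarith)
  rw [hβ] at hhi' hx2
  exact isGeneralSingularValueCluster_of_bounds hp hα (hx1.trans hx2) hf.1 hlo hhi'
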